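/- Let $R\subset\mathbb R^d\setminus\{0\}$ be a root system, that is, a finite set with $\sigma_\nu(\mu)\in R$ for all $\nu,\mu\in R$, where $\sigma_\nu(x)=x-2\frac{\langle\nu,x\rangle}{|\nu|^2}\nu$. Let $R_+$ be a positive subsystem: $R_+=\{\nu\in R:\langle\beta,\nu\rangle>0\}$ for some $\beta\in\mathbb R^d$ with $\langle\beta,\nu\rangle\ne0$ for all $\nu\in R$. Let $\kappa$ be a non-negative multiplicity function on $R$, i.e. a function $R\to[0,\infty)$ invariant under the group generated by the reflections $\sigma_\nu$, $\nu\in R$. Put $$\gamma_\kappa=\sum_{\nu\in R_+}\kappa(\nu),\qquad h_\kappa^2(x)=\prod_{\nu\in R_+}|\langle x,\nu\rangle|^{2\kappa(\nu)},\qquad M_\kappa=\Big(\int_{\mathbb R^d}e^{-|x|^2/2}h_\kappa^2(x)\,dx\Big)^{-1}.$$ For $\xi\in\mathbb R^d$ let $\partial_\xi$ be the directional derivative and $$T_\xi f(x)=\partial_\xi f(x)+\sum_{\nu\in R_+}\kappa(\nu)\langle\nu,\xi\rangle\frac{f(x)-f(\sigma_\nu x)}{\langle\nu,x\rangle}$$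 the Dunkl operator. Let $V_\kappa$ be the intertwining operator: the unique linear isomorphism of the space of complex polynomials in $d$ variables that maps the space of homogeneous polynomials of degree $m$ onto itself for every $m\ge0$, is the identity on constants, and satisfies $T_\xi V_\kappa=V_\kappa\partial_\xi$ for all $\xi\in\mathbb R^d$. Let $$E_\kappa(z,w)=V_\kappa\big(e^{\langle\cdot,w\rangle}\big)(z)=\sum_{n\ge0}\frac1{n!}V_\kappa\big(\langle\cdot,w\rangle^n\big)(z),\qquad z,w\in\mathbb C^d,\quad \langle z,w\rangle=\sum_j z_jw_j,$$ be the Dunkl kernel. Let $$K_{it}(x,y)=\frac{M_\kappa}{(i\sin 2t)^{\frac d2+\gamma_\kappa}}\,e^{\frac i2\cot(2t)(|x|^2+|y|^2)}\,E_\kappa\Big(\frac{x}{i\sin 2t},y\Big)\qquad(0<|t|<\tfrac\pi2),$$ $$L_{it}(x,y)=\frac{M_\kappa}{(2it)^{\gamma_\kappa+\frac d2}}\,e^{\frac{i(|x|^2+|y|^2)}{4t}}\,E_\kappa\Big(\frac{x}{2it},y\Big)\qquad(t\ne0),$$ with principal powers, be the explicit Schrödinger kernels associated with the Dunkl Hermite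 operator $-\Delta_\kappa+|x|^2$ and the Dunkl Laplacian $\Delta_\kappa=\sum_{j}T_{e_j}^2$, respectively. Then for all $v>0$ and $x,y\in\mathbb R^d$, $$K_{i\frac{\tan^{-1}v}{2}}(x,y)=(1+v^2)^{\frac{d+2\gamma_\kappa}{4}}\,e^{-\frac{iv}{2}|x|^2}\,L_{\frac{iv}{2}}\big(x\sqrt{1+v^2},\,y\big).$$ -/

import Mathlib

noncomputable section

namespace Dunkl

/-- The space `ℝ^d` with its Euclidean norm and inner product. -/
abbrev E (d : ℕ) : Type := EuclideanSpace ℝ (Fin d)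

/-- The reflection `σ_ν` in the hyperplane perpendicular to `ν`,
`σ_ν x = x - 2 (⟨ν, x⟩ / |ν|²) ν`. -/
def reflection {d : ℕ} (ν : E d) : E d ≃ₗᵢ[ℝ] E d := (ℝ ∙ ν)ᗮ.reflection

/-- A root system: a finite set of nonzero vectors that is stable under the reflections in
its elements. (It need be neither reduced, nor crystallographic, nor spanning.) -/
structure IsRootSystem {d : ℕ} (R : Finset (E d)) : Prop where
  ne_zero : ∀ ν ∈ R, ν ≠ 0
  reflection_mem : ∀ ν ∈ R, ∀ μ ∈ R, reflection ν μ ∈ R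

/-- `Rp` is a positive subsystem of `R`: the part of `R` lying strictly on one side of a
hyperplane through the origin that contains no element of `R`. -/
def IsPositiveSubsystem {d : ℕ} (R Rp : Finset (E d)) : Prop :=
  ∃ β : E d, (∀ ν ∈ R, inner ℝ β ν ≠ 0) ∧ ∀ ν : E d, ν ∈ Rp ↔ ν ∈ R ∧ 0 < inner ℝ β ν

/-- The finite reflection group generated by the reflections `σ_ν`, `ν ∈ R`. -/
def reflectionGroup {d : ℕ} (R : Finset (E d)) : Subgroup (E d ≃ₗᵢ[ℝ] E d) :=
  Subgroup.closure (reflection '' (R : Set (E d)))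

/-- A non-negative multiplicity function on `R` (only its values on `R` matter). -/
structure IsMultiplicity {d : ℕ} (R : Finset (E d)) (κ : E d → ℝ) : Prop where
  nonneg : ∀ ν ∈ R, 0 ≤ κ ν
  invariant : ∀ g ∈ reflectionGroup R, ∀ ν ∈ R, κ (g ν) = κ ν

/-- `γ_κ = ∑_{ν ∈ R₊} κ(ν)`. -/
def gammaIndex {d : ℕ} (Rp : Finset (E d)) (κ : E d → ℝ) : ℝ := ∑ ν ∈ Rp, κ ν

/-- The weight `h_κ²(x) = ∏_{ν ∈ R₊} |⟨x, ν⟩|^{2κ(ν)}`. -/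
def weight {d : ℕ} (Rp : Finset (E d)) (κ : E d → ℝ) (x : E d) : ℝ :=
  ∏ ν ∈ Rp, |inner ℝ x ν| ^ (2 * κ ν)

/-- `M_κ = (∫ e^{-|x|²/2} h_κ²(x) dx)⁻¹`. -/
def normConst {d : ℕ} (Rp : Finset (E d)) (κ : E d → ℝ) : ℝ :=
  (∫ x : E d, Real.exp (-‖x‖ ^ 2 / 2) * weight Rp κ x)⁻¹

/-- Polynomials with complex coefficients in `d` variables. -/
abbrev Poly (d : ℕ) : Type := MvPolynomial (Fin d) ℂ

/-- The linear form `∑ j, w_j x_j`, for `w ∈ ℂ^d`. -/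
def linForm {d : ℕ} (w : Fin d → ℂ) : Poly d :=
  ∑ j, MvPolynomial.C (w j) * MvPolynomial.X j

/-- The linear form `⟨ν, ·⟩`, for `ν ∈ ℝ^d`. -/
def rootForm {d : ℕ} (ν : E d) : Poly d := linForm fun j => ((ν j : ℝ) : ℂ)

/-- `p ↦ p ∘ σ_ν` on polynomials: the substitution `x_i ↦ x_i - 2 ν_i ⟨ν, x⟩ / |ν|²`. -/
def reflPoly {d : ℕ} (ν : E d) : Poly d →ₐ[ℂ] Poly d :=
  MvPolynomial.aeval fun i =>
    MvPolynomial.X i - MvPolynomial.C (((2 * ν i / ‖ν‖ ^ 2 : ℝ)) : ℂ) * rootForm ν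

theorem exists_divDiff {d : ℕ} (ν : E d) (p : Poly d) :
    ∃ q : Poly d, p - reflPoly ν p = rootForm ν * q := by
  induction p using MvPolynomial.induction_on with
  | C a => exact ⟨0, by simp [reflPoly]⟩
  | add p q hp hq =>
    obtain ⟨a, ha⟩ := hp
    obtain ⟨b, hb⟩ := hq
    exact ⟨a + b, by rw [map_add, mul_add, ← ha, ← hb]; ring⟩
  | mul_X p i hp =>
    obtain ⟨a, ha⟩ := hp
    refine ⟨a * MvPolynomial.X i +
      reflPoly ν p * MvPolynomial.C (((2 * ν i / ‖ν‖ ^ 2 : ℝ)) : ℂ), ?_⟩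
    have hX : reflPoly ν (MvPolynomial.X i) = MvPolynomial.X i -
        MvPolynomial.C (((2 * ν i / ‖ν‖ ^ 2 : ℝ)) : ℂ) * rootForm ν := by
      simp [reflPoly]
    rw [map_mul, hX]
    linear_combination (MvPolynomial.X i) * ha

/-- The polynomial `(p(x) - p(σ_ν x)) / ⟨ν, x⟩`. It is unique for `ν ≠ 0`. -/
def divDiff {d : ℕ} (ν : E d) (p : Poly d) : Poly d := (exists_divDiff ν p).choose

/-- The directional derivative `∂_ξ`. -/
def dirDeriv {d : ℕ} (ξ : E d) (p : Poly d) : Poly d :=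
  ∑ j, MvPolynomial.C ((ξ j : ℝ) : ℂ) * MvPolynomial.pderiv j p

/-- The Dunkl operator
`T_ξ p(x) = ∂_ξ p(x) + ∑_{ν ∈ R₊} κ(ν) ⟨ν, ξ⟩ (p(x) - p(σ_ν x)) / ⟨ν, x⟩` on polynomials. -/
def dunklOp {d : ℕ} (Rp : Finset (E d)) (κ : E d → ℝ) (ξ : E d) (p : Poly d) : Poly d :=
  dirDeriv ξ p + ∑ ν ∈ Rp, MvPolynomial.C ((κ ν * inner ℝ ν ξ : ℝ) : ℂ) * divDiff ν p

/-- `V` is a linear isomorphism of the space of polynomials that preserves each space of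
homogeneous polynomials, is the identity on constants, and satisfies `T_ξ V = V ∂_ξ`. -/
structure IsIntertwining {d : ℕ} (Rp : Finset (E d)) (κ : E d → ℝ)
    (V : Poly d ≃ₗ[ℂ] Poly d) : Prop where
  map_homogeneous : ∀ m : ℕ,
    (MvPolynomial.homogeneousSubmodule (Fin d) ℂ m).map (V : Poly d →ₗ[ℂ] Poly d) =
      MvPolynomial.homogeneousSubmodule (Fin d) ℂ m
  map_const : ∀ c : ℂ, V (MvPolynomial.C c) = MvPolynomial.C c
  intertwines : ∀ (ξ : E d) (p : Poly d), dunklOp Rp κ ξ (V p) = V (dirDeriv ξ p)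

instance nonempty_polyEquiv {d : ℕ} : Nonempty (Poly d ≃ₗ[ℂ] Poly d) := ⟨LinearEquiv.refl ℂ (Poly d)⟩

/-- The intertwining operator `V_κ`: the linear isomorphism determined by `IsIntertwining`
(for a non-negative multiplicity function there is exactly one such isomorphism). -/
def intertwiningOp {d : ℕ} (Rp : Finset (E d)) (κ : E d → ℝ) : Poly d ≃ₗ[ℂ] Poly d :=
  Classical.epsilon (IsIntertwining Rp κ)

/-- The Dunkl kernel `E_κ(z, w) = V_κ(e^{⟨·, w⟩})(z)` on `ℂ^d × ℂ^d`, where `V_κ` acts on the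
exponential through its expansion `∑ n, ⟨·, w⟩^n / n!` in homogeneous polynomials and
`⟨x, w⟩ = ∑ j, x_j w_j` is bilinear. -/
def dunklKernel {d : ℕ} (Rp : Finset (E d)) (κ : E d → ℝ) (z w : Fin d → ℂ) : ℂ :=
  ∑' n : ℕ, MvPolynomial.eval z
    (intertwiningOp Rp κ (MvPolynomial.C ((n.factorial : ℂ)⁻¹) * linForm w ^ n))

/-- The kernel `K_{it}(x, y)` of `e^{-itH_κ}`, with the principal power
(the correct branch for `0 < |t| < π/2`). -/
def hermiteKernel {d : ℕ} (Rp : Finset (E d)) (κ : E d → ℝ) (t : ℝ) (x y : E d) : ℂ :=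
  (normConst Rp κ : ℂ) /
      (Complex.I * (Real.sin (2 * t) : ℂ)) ^ ((d : ℂ) / 2 + (gammaIndex Rp κ : ℂ)) *
    Complex.exp (Complex.I / 2 * (Real.cot (2 * t) : ℂ) * ((‖x‖ ^ 2 + ‖y‖ ^ 2 : ℝ) : ℂ)) *
    dunklKernel Rp κ (fun j => ((x j : ℝ) : ℂ) / (Complex.I * (Real.sin (2 * t) : ℂ)))
      (fun j => ((y j : ℝ) : ℂ))

/-- The kernel `L_{it}(x, y)` of `e^{itΔ_κ}`, with the principal power (`t ≠ 0`). -/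
def laplaceKernel {d : ℕ} (Rp : Finset (E d)) (κ : E d → ℝ) (t : ℝ) (x y : E d) : ℂ :=
  (normConst Rp κ : ℂ) /
      (2 * Complex.I * (t : ℂ)) ^ ((gammaIndex Rp κ : ℂ) + (d : ℂ) / 2) *
    Complex.exp (Complex.I * ((‖x‖ ^ 2 + ‖y‖ ^ 2 : ℝ) : ℂ) / (4 * (t : ℂ))) *
    dunklKernel Rp κ (fun j => ((x j : ℝ) : ℂ) / (2 * Complex.I * (t : ℂ)))
      (fun j => ((y j : ℝ) : ℂ))

end Dunkl

end

/-! With `2t = arctan v` and `s = √(1 + v²)`, one has `sin 2t = v / s` and `cot 2t = 1 / v`, so `i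
sin 2t` is `iv`, the constant `2i · (v/2)` of the Laplace kernel, divided by the positive number
`s`. The three factors then match separately. In the Dunkl kernel, `1/s` moves onto `x` as dilation
by `s`, so the arguments agree and no property of the kernel itself enters. In the power, `1/s` is
positive and splits off the principal branch, leaving the prefactor. In the Gaussian, dilating `x`
costs an extra `iv|x|²/2`, which the chirp cancels. -/

/-- A positive real factor can be pulled out of a principal power. -/
theorem Complex.ofReal_mul_cpow {r : ℝ} (hr : 0 < r) {z : ℂ} (hz : z ≠ 0) (a : ℂ) :
    ((r : ℂ) * z) ^ a = (r : ℂ) ^ a * z ^ a := by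
  have hr' : (r : ℂ) ≠ 0 := Complex.ofReal_ne_zero.2 hr.ne'
  rw [Complex.cpow_def_of_ne_zero (mul_ne_zero hr' hz), Complex.cpow_def_of_ne_zero hr',
    Complex.cpow_def_of_ne_zero hz, Complex.log_ofReal_mul hr hz, ← Complex.ofReal_log hr.le,
    add_mul, Complex.exp_add]

theorem Real.cot_arctan (v : ℝ) : Real.cot (Real.arctan v) = v⁻¹ := by
  rw [← Real.tan_inv_eq_cot, Real.tan_arctan]

theorem lemma3p1 {d : ℕ} (R Rp : Finset (Dunkl.E d)) (κ : Dunkl.E d → ℝ)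
    (hR : Dunkl.IsRootSystem R) (hRp : Dunkl.IsPositiveSubsystem R Rp)
    (hκ : Dunkl.IsMultiplicity R κ) (v : ℝ) (hv : 0 < v) (x y : Dunkl.E d) :
    Dunkl.hermiteKernel Rp κ (Real.arctan v / 2) x y =
      (((1 + v ^ 2) ^ (((d : ℝ) + 2 * Dunkl.gammaIndex Rp κ) / 4) : ℝ) : ℂ) *
        Complex.exp (-(Complex.I * (v : ℂ) / 2) * ((‖x‖ ^ 2 : ℝ) : ℂ)) *
        Dunkl.laplaceKernel Rp κ (v / 2) (Real.sqrt (1 + v ^ 2) • x) y := by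
  set s : ℝ := Real.sqrt (1 + v ^ 2) with hs
  have hs_pos : 0 < s := Real.sqrt_pos.2 (by positivity)
  have hs_sq : s ^ 2 = 1 + v ^ 2 := Real.sq_sqrt (by positivity)
  have hsC : (s : ℂ) ≠ 0 := Complex.ofReal_ne_zero.2 hs_pos.ne'
  have hvC : (v : ℂ) ≠ 0 := Complex.ofReal_ne_zero.2 hv.ne'
  have hIv : Complex.I * (v : ℂ) ≠ 0 := mul_ne_zero Complex.I_ne_zero hvC
  have hsin : Complex.I * ((v / s : ℝ) : ℂ) = ((s⁻¹ : ℝ) : ℂ) * (Complex.I * v) := by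
    push_cast; ring
  have htwo : 2 * Complex.I * ((v / 2 : ℝ) : ℂ) = Complex.I * v := by push_cast; ring
  -- Writing `1 + v²` as `s²` doubles the exponent, giving exactly the kernels' exponent `d/2 +
  -- γ_κ`.
  have hpow : (((1 + v ^ 2) ^ (((d : ℝ) + 2 * Dunkl.gammaIndex Rp κ) / 4) : ℝ) : ℂ) =
      (s : ℂ) ^ ((d : ℂ) / 2 + (Dunkl.gammaIndex Rp κ : ℂ)) := by
    rw [← hs_sq, ← Real.rpow_natCast, ← Real.rpow_mul hs_pos.le,
      Complex.ofReal_cpow hs_pos.le]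
    congr 1
    push_cast; ring
  -- Inversion commutes with the principal power off the negative axis; here `arg s = 0 ≠ π`.
  have hinv : ((s⁻¹ : ℝ) : ℂ) ^ ((d : ℂ) / 2 + (Dunkl.gammaIndex Rp κ : ℂ)) =
      ((s : ℂ) ^ ((d : ℂ) / 2 + (Dunkl.gammaIndex Rp κ : ℂ)))⁻¹ := by
    rw [Complex.ofReal_inv, Complex.inv_cpow]
    rw [Complex.arg_ofReal_of_nonneg hs_pos.le]
    exact Real.pi_pos.ne
  have hnorm : ‖s • x‖ ^ 2 = (1 + v ^ 2) * ‖x‖ ^ 2 := by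
    rw [norm_smul, mul_pow, Real.norm_eq_abs, sq_abs, hs_sq]
  have hexp : Complex.exp (Complex.I / 2 * ((v⁻¹ : ℝ) : ℂ) * ((‖x‖ ^ 2 + ‖y‖ ^ 2 : ℝ) : ℂ)) =
      Complex.exp (-(Complex.I * (v : ℂ) / 2) * ((‖x‖ ^ 2 : ℝ) : ℂ)) *
        Complex.exp (Complex.I * ((‖s • x‖ ^ 2 + ‖y‖ ^ 2 : ℝ) : ℂ) /
          (4 * ((v / 2 : ℝ) : ℂ))) := by
    -- The coefficients of `|x|²` agree because `1/v = -v + (1 + v²)/v`; those of `|y|²` are both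
    -- `i/(2v)`.
    rw [← Complex.exp_add, hnorm]
    congr 1
    push_cast
    field_simp
    ring
  have harg : (fun j => ((x j : ℝ) : ℂ) / (((s⁻¹ : ℝ) : ℂ) * (Complex.I * v))) =
      fun j => (((s • x) j : ℝ) : ℂ) / (Complex.I * v) := by
    funext j
    rw [PiLp.smul_apply, smul_eq_mul]
    push_cast
    field_simp
  unfold Dunkl.hermiteKernel Dunkl.laplaceKernel
  rw [mul_div_cancel₀ _ (two_ne_zero' ℝ), Real.sin_arctan, Real.cot_arctan, ← hs, hsin, htwo,
    harg, hexp, hpow, Complex.ofReal_mul_cpow (inv_pos.2 hs_pos) hIv, hinv,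
    add_comm (Dunkl.gammaIndex Rp κ : ℂ), div_eq_mul_inv, mul_inv, inv_inv, div_eq_mul_inv]
  ring
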